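/- Let $n\ge 1$ and let $\mathcal K_0$ be the set of compact convex sets in $\mathbb R^n$ containing the origin in their interior. For $K\in\mathcal K_0$ let $|K|$ be its volume, $h_K(u)=\max_{x\in K}\langle x,u\rangle$ its support function, $K^\circ=\{y:\langle x,y\rangle\le 1\ \forall x\in K\}$ its polar body, and $S(K,\cdot)$ its surface area measure on $S^{n-1}$: for a Borel set $A\subseteq S^{n-1}$, $S(K,A)$ is the $(n-1)$-dimensional Hausdorff measure (normalized to agree with Lebesgue measure on hyperplanes) of the set of points of $\partial K$ at which $K$ has an outer unit normal in $A$ (the points of $\partial K$ with more than one outer unit normal form a null set and may be disregarded). For $p\in\mathbb R$ and $K,Q\in\mathcal K_0$ put $dS_p(K,u)=h_K(u)^{1-p}\,dS(K,u)$ and $$V_p(K,Q)=\frac1n\int_{S^{n-1}}h_Q(u)^p\,dS_p(K,u).$$ For $p\neq -n$ the $L_p$ geominimal surface area $\tilde G_p(K)\in[0,\infty]$ is $$\tilde G_p(K)=\inf_{Q\in\mathcal K_0}\Big\{n\,V_p(K,Q)^{\frac n{n+p}}|Q^\circ|^{\frac p{n+p}}\Big\}\ \ (p\ge 0),\qquad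 \tilde G_p(K)=\sup_{Q\in\mathcal K_0}\Big\{n\,V_p(K,Q)^{\frac n{n+p}}|Q^\circ|^{\frac p{n+p}}\Big\}\ \ (p<0,\ p\ne -n).$$ (The supremum may be $+\infty$; powers are read in $[0,\infty]$, with $\infty^{a}=\infty$ for $a>0$ and $\infty^{a}=0$ for $a<0$.) **Theorem.** Let $K\in\mathcal K_0$ and let $p,q$ be nonzero real numbers. (i) If either $-n<q<p$ or $q<p<-n$, then $$\bigg(\frac{\tilde G_q(K)}{n|K|}\bigg)^{\frac{n+q}{q}}\le\bigg(\frac{\tilde G_p(K)}{n|K|}\bigg)^{\frac{n+p}{p}}.$$ (ii) If $q<-n<p$, then $$\bigg(\frac{\tilde G_q(K)}{n|K|}\bigg)^{\frac{n+q}{q}}\ge\bigg(\frac{\tilde G_p(K)}{n|K|}\bigg)^{\frac{n+p}{p}}.$$ -/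

import Mathlib

open MeasureTheory Set
open scoped ENNReal RealInnerProductSpace

noncomputable section

namespace Geominimal

/-- Euclidean space `ℝⁿ`. -/
abbrev E (n : ℕ) : Type := EuclideanSpace ℝ (Fin n)

/-- The unit sphere `S^{n-1}` of `ℝⁿ`. -/
abbrev S (n : ℕ) : Type := Metric.sphere (0 : E n) 1

variable {n : ℕ}

/-- The class `𝒦₀` of convex bodies (compact convex sets) that contain the origin
in their interior; in particular the interior is nonempty. -/
def K0 (n : ℕ) : Set (ConvexBody (E n)) :=
  {K | (0 : E n) ∈ interior (K : Set (E n))}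

/-- The support function `h_K(u) = max {⟪x, u⟫ : x ∈ K}`. -/
def supportFn (K : ConvexBody (E n)) (u : E n) : ℝ :=
  sSup ((fun x : E n => ⟪x, u⟫) '' (K : Set (E n)))

/-- The (one-sided) polar body `K° = {y : ⟪x, y⟫ ≤ 1 for all x ∈ K}`. -/
def polarBody (K : ConvexBody (E n)) : Set (E n) :=
  {y | ∀ x ∈ K, ⟪x, y⟫ ≤ 1}

/-- The unit vector `u` is an outer normal of `K` at `x`: the hyperplane through `x`
orthogonal to `u` supports `K`, and `K` lies on the side opposite to `u`. -/
def IsOuterNormal (K : ConvexBody (E n)) (x : E n) (u : S n) : Prop :=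
  ∀ y ∈ K, ⟪y, (u : E n)⟫ ≤ ⟪x, (u : E n)⟫

/-- The regular boundary points of `K`: those with exactly one outer unit normal. All
boundary points outside an `(n-1)`-dimensional null set are regular. -/
def regularBoundary (K : ConvexBody (E n)) : Set (E n) :=
  {x | x ∈ frontier (K : Set (E n)) ∧ ∃! u : S n, IsOuterNormal K x u}

/-- The Gauss map, sending a regular boundary point to its outer unit normal. -/
def gaussMap (K : ConvexBody (E n)) (x : regularBoundary K) : S n :=
  x.2.2.choose

/-- The surface area measure `S(K, ·)` on the sphere. The mass of a Borel set `A` is the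
`(n-1)`-dimensional Hausdorff measure (normalized so as to agree with Lebesgue measure on
hyperplanes) of the set of boundary points of `K` with an outer unit normal in `A`. It is
built as the image under the Gauss map of the Hausdorff measure on the regular
boundary; see `surfaceAreaMeasure_apply`. -/
def surfaceAreaMeasure (K : ConvexBody (E n)) : Measure (S n) :=
  Measure.map (gaussMap K)
    (Measure.comap Subtype.val (Measure.euclideanHausdorffMeasure (n - 1) : Measure (E n)))

/-- The `p`-surface area measure `dS_p(K, u) = h_K(u)^{1-p} dS(K, u)`. -/
def pSurfaceAreaMeasure (p : ℝ) (K : ConvexBody (E n)) : Measure (S n) :=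
  (surfaceAreaMeasure K).withDensity (fun u => ENNReal.ofReal (supportFn K u ^ (1 - p)))

/-- The `p`-mixed volume `V_p(K, Q) = (1/n) ∫ h_Q(u)^p dS_p(K, u)`. -/
def mixedVolume (p : ℝ) (K Q : ConvexBody (E n)) : ℝ≥0∞ :=
  (n : ℝ≥0∞)⁻¹ * ∫⁻ u : S n, ENNReal.ofReal (supportFn Q u ^ p) ∂(pSurfaceAreaMeasure p K)

/-- The functional `n V_p(K, Q)^{n/(n+p)} |Q°|^{p/(n+p)}`. -/
def geominimalFunctional (p : ℝ) (K Q : ConvexBody (E n)) : ℝ≥0∞ :=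
  (n : ℝ≥0∞) * mixedVolume p K Q ^ ((n : ℝ) / (n + p)) *
    volume (polarBody Q) ^ (p / ((n : ℝ) + p))

open scoped Classical in
/-- The `L_p` geominimal surface area for `p ≠ -n`: the infimum over `Q ∈ 𝒦₀` if `p ≥ 0`,
and the supremum if `p < 0`. It takes values in `[0, ∞]`, since the supremum can be infinite
(it is so when `K` is a polytope and `n ≥ 2`). -/
def geominimal (p : ℝ) (K : ConvexBody (E n)) : ℝ≥0∞ :=
  if 0 ≤ p then ⨅ Q ∈ K0 n, geominimalFunctional p K Q
  else ⨆ Q ∈ K0 n, geominimalFunctional p K Q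

theorem isClosed_isOuterNormal (K : ConvexBody (E n)) :
    IsClosed {z : E n × S n | IsOuterNormal K z.1 z.2} := by
  have h : {z : E n × S n | IsOuterNormal K z.1 z.2} =
      ⋂ y ∈ K, {z : E n × S n | ⟪y, (z.2 : E n)⟫ ≤ ⟪z.1, (z.2 : E n)⟫} := by
    ext z
    simp only [mem_iInter]
    rfl
  rw [h]
  exact isClosed_iInter fun y => isClosed_iInter fun _ =>
    isClosed_le (by fun_prop) (by fun_prop)

/-- For closed `C ⊆ S × S`, the boundary points with a pair of outer normals in `C`
form a closed set. -/
theorem isClosed_normals (K : ConvexBody (E n)) {C : Set (S n × S n)} (hC : IsClosed C) :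
    IsClosed {x : E n | x ∈ frontier (K : Set (E n)) ∧
      ∃ w ∈ C, IsOuterNormal K x w.1 ∧ IsOuterNormal K x w.2} := by
  have hcl : IsClosed {z : E n × (S n × S n) | z.1 ∈ frontier (K : Set (E n)) ∧ z.2 ∈ C ∧
      IsOuterNormal K z.1 z.2.1 ∧ IsOuterNormal K z.1 z.2.2} := by
    have h := isClosed_isOuterNormal K
    exact (isClosed_frontier.preimage continuous_fst).inter
      ((hC.preimage continuous_snd).inter (IsClosed.inter
        (h.preimage (f := fun z : E n × (S n × S n) => (z.1, z.2.1)) (by fun_prop))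
        (h.preimage (f := fun z : E n × (S n × S n) => (z.1, z.2.2)) (by fun_prop))))
  have hproj := isClosedMap_fst_of_compactSpace (X := E n) (Y := S n × S n) _ hcl
  convert hproj using 1
  ext x
  constructor
  · rintro ⟨hx, w, hw, h⟩
    exact ⟨(x, w), ⟨hx, hw, h⟩, rfl⟩
  · rintro ⟨⟨x', w⟩, ⟨hx, hw, h⟩, rfl⟩
    exact ⟨hx, w, hw, h⟩

theorem measurableSet_regularBoundary (K : ConvexBody (E n)) :
    MeasurableSet (regularBoundary K) := by
  have h : regularBoundary K =
      {x : E n | x ∈ frontier (K : Set (E n)) ∧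
        ∃ w ∈ (univ : Set (S n × S n)), IsOuterNormal K x w.1 ∧ IsOuterNormal K x w.2} \
      ⋃ k : ℕ, {x : E n | x ∈ frontier (K : Set (E n)) ∧
        ∃ w ∈ {w : S n × S n | 1 / ((k : ℝ) + 1) ≤ dist w.1 w.2},
          IsOuterNormal K x w.1 ∧ IsOuterNormal K x w.2} := by
    ext x
    simp only [regularBoundary, mem_ofPred_eq, mem_sdiff, mem_iUnion, mem_univ, true_and]
    constructor
    · rintro ⟨hx, u, hu, huniq⟩
      refine ⟨⟨hx, (u, u), hu, hu⟩, ?_⟩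
      rintro ⟨k, -, ⟨v, w⟩, hk, hv, hw⟩
      have hvw : v = w := (huniq v hv).trans (huniq w hw).symm
      subst hvw
      have : (0 : ℝ) < 1 / ((k : ℝ) + 1) := by positivity
      simp only [dist_self] at hk
      linarith
    · rintro ⟨⟨hx, w, hw, -⟩, hno⟩
      refine ⟨hx, w.1, hw, fun v hv => ?_⟩
      by_contra hne
      obtain ⟨k, hk⟩ := exists_nat_one_div_lt (dist_pos.2 hne)
      exact hno ⟨k, hx, (v, w.1), hk.le, hv, hw⟩
  rw [h]
  refine (isClosed_normals K isClosed_univ).measurableSet.diff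
    (MeasurableSet.iUnion fun k => (isClosed_normals K ?_).measurableSet)
  exact isClosed_le continuous_const (by fun_prop)

theorem gaussMap_preimage (K : ConvexBody (E n)) (A : Set (S n)) :
    gaussMap K ⁻¹' A = Subtype.val ⁻¹' {x : E n | ∃ u ∈ A, IsOuterNormal K x u} := by
  ext x
  constructor
  · intro hx
    exact ⟨gaussMap K x, hx, x.2.2.choose_spec.1⟩
  · rintro ⟨u, hu, hn⟩
    have : u = gaussMap K x := x.2.2.choose_spec.2 u hn
    rw [this] at hu
    exact hu

theorem measurable_gaussMap (K : ConvexBody (E n)) : Measurable (gaussMap K) := by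
  refine measurable_of_isClosed fun A hA => ?_
  have h := (isClosed_normals K (hA.preimage (continuous_fst (Y := S n)))).measurableSet
  have heq : gaussMap K ⁻¹' A = (Subtype.val : regularBoundary K → E n) ⁻¹'
      {x : E n | x ∈ frontier (K : Set (E n)) ∧
        ∃ w ∈ Prod.fst ⁻¹' A, IsOuterNormal K x w.1 ∧ IsOuterNormal K x (w : S n × S n).2} := by
    rw [gaussMap_preimage]
    ext x
    constructor
    · rintro ⟨u, hu, hn⟩
      exact ⟨x.2.1, (u, u), hu, hn, hn⟩
    · rintro ⟨-, w, hw, hn, -⟩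
      exact ⟨w.1, hw, hn⟩
  rw [heq]
  exact measurable_subtype_coe h

/-- The mass of a Borel set `A` under the surface area measure. -/
theorem surfaceAreaMeasure_apply (K : ConvexBody (E n)) {A : Set (S n)}
    (hA : MeasurableSet A) :
    surfaceAreaMeasure K A =
      (Measure.euclideanHausdorffMeasure (n - 1) : Measure (E n))
        {x : E n | x ∈ regularBoundary K ∧ ∃ u ∈ A, IsOuterNormal K x u} := by
  rw [surfaceAreaMeasure, Measure.map_apply (measurable_gaussMap K) hA,
    (MeasurableEmbedding.subtype_coe (measurableSet_regularBoundary K)).comap_apply,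
    gaussMap_preimage, Subtype.image_preimage_coe]
  rfl

end Geominimal

end

noncomputable section

namespace Geominimal

variable {n : ℕ}
open scoped NNReal Pointwise Topology

/-! The normalized cone-volume measure μ = h_K dS(K,·)/(n|K|) is a probability measure on the
sphere, and V_p(K,Q) = |K| ∫ (h_Q/h_K)^p dμ (`mixedVolume_eq`). Dividing the functional by n|K| and
raising it to the power (n+p)/p therefore leaves ‖h_Q/h_K‖_p^n |Q°|/|K|, with the norm taken in
L^p(μ) (`geominimalFunctional_div_rpow`). For fixed Q this is nondecreasing in p, because power
means are (`lintegral_rpow_rpow_inv_mono`). The exponent (n+p)/p is negative exactly for -n < p < 0,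
where it turns the supremum into an infimum; so the quantity compared is an infimum over Q for every
p > -n and a supremum for p < -n. Within either range the inequality passes to the extremum. Across
-n, the test body Q = K gives |K°|/|K| for every exponent, which lies above the infimum and below
the supremum.

That μ has mass one is the formula |K| = (1/n) ∫ h_K dS(K,·) (`coneVolumeMeasure_univ`), which takes
most of the work. The cone over the regular boundary is almost all of K, by Rademacher's theorem for
the gauge. Cut the sphere into small pieces: the boundary points with normal in one piece form an
almost flat set, and its cone is bi-Lipschitz, with constants near 1, to a cone over a flat base,
whose volume is height times area over n. Summing over the pieces and refining gives equality. -/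

/-! ### Cones over flat and nearly flat bases -/

/-- If the indexed family `a` is `L`-Lipschitz relative to the indexed family `b`, the Hausdorff
measures of their images compare accordingly. -/
theorem euclideanHausdorffMeasure_image_le_image {ι X Y : Type*} [EMetricSpace X]
    [MeasurableSpace X] [BorelSpace X] [EMetricSpace Y] [MeasurableSpace Y] [BorelSpace Y]
    (a : ι → X) (b : ι → Y) (I : Set ι) (L : ℝ≥0)
    (h : ∀ i ∈ I, ∀ j ∈ I, edist (a i) (a j) ≤ L * edist (b i) (b j)) (d : ℕ) :
    (Measure.euclideanHausdorffMeasure d : Measure X) (a '' I) ≤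
      (L : ℝ≥0∞) ^ d * (Measure.euclideanHausdorffMeasure d : Measure Y) (b '' I) := by
  rcases I.eq_empty_or_nonempty with rfl | ⟨i₀, hi₀⟩
  · simp
  have : Nonempty ι := ⟨i₀⟩
  have hinv : ∀ y ∈ b '' I, Function.invFunOn b I y ∈ I ∧ b (Function.invFunOn b I y) = y :=
    fun y hy => ⟨Function.invFunOn_mem hy, Function.invFunOn_eq hy⟩
  have hlip : LipschitzOnWith L (a ∘ Function.invFunOn b I) (b '' I) := by
    intro x hx y hy
    have := h _ (hinv x hx).1 _ (hinv y hy).1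
    rwa [(hinv x hx).2, (hinv y hy).2] at this
  -- Points with equal `b` have equal `a`, by the hypothesis, so `a` factors through `b` whichever
  -- preimage is chosen.
  have himg : a '' I ⊆ (a ∘ Function.invFunOn b I) '' (b '' I) := by
    rintro _ ⟨i, hi, rfl⟩
    refine ⟨b i, ⟨i, hi, rfl⟩, ?_⟩
    have hm := hinv (b i) ⟨i, hi, rfl⟩
    have := h _ hm.1 i hi
    rw [hm.2, edist_self, mul_zero] at this
    exact edist_le_zero.1 this
  have key := hlip.hausdorffMeasure_image_le (d := d) (Nat.cast_nonneg d)
  rw [ENNReal.rpow_natCast] at key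
  simp only [Measure.euclideanHausdorffMeasure_def, Measure.smul_apply, ENNReal.smul_def,
    smul_eq_mul]
  calc _ ≤ _ * ((L : ℝ≥0∞) ^ d * Measure.hausdorffMeasure (d : ℝ) (b '' I)) := by
        gcongr
        exact (measure_mono himg).trans key
    _ = _ := by ring

/-- The open cone with base `A` and apex the origin, without the apex. -/
def openCone (A : Set (E n)) : Set (E n) :=
  (fun z : ℝ × E n => z.1 • z.2) '' (Ioo 0 1 ×ˢ A)

theorem openCone_iUnion {ι : Sort*} (A : ι → Set (E n)) :
    openCone (⋃ i, A i) = ⋃ i, openCone (A i) := by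
  simp only [openCone, prod_iUnion, image_iUnion]

theorem volume_eq_euclideanHausdorffMeasure :
    (volume : Measure (E n)) = Measure.euclideanHausdorffMeasure n :=
  (EuclideanSpace.euclideanHausdorffMeasure_eq_volume n).symm

/-- Measurability of a cone whose base meets every ray from the origin at most once, as
witnessed by a positively homogeneous function `g` equal to one on the base. -/
theorem measurableSet_openCone {A : Set (E n)} (hA : MeasurableSet A) (g : E n → ℝ)
    (hg : ∀ t : ℝ, 0 < t → ∀ y ∈ A, g (t • y) = t) : MeasurableSet (openCone A) := by
  -- Lusin–Souslin: an injective continuous image of a Borel set is Borel. The function `g` recovers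
  -- `t` from `t • y`, hence also `y`.
  refine (measurableSet_Ioo.prod hA).image_of_continuousOn_injOn (by fun_prop) ?_
  rintro ⟨t, y⟩ ⟨ht, hy⟩ ⟨t', y'⟩ ⟨ht', hy'⟩ h
  simp only at h ht ht' hy hy'
  have h1 := hg t ht.1 y hy
  rw [h, hg t' ht'.1 y' hy'] at h1
  subst h1
  rw [smul_right_injective _ ht.1.ne' h]

/-- The volume of the cone over a subset of the hyperplane at distance `s` from the origin. -/
theorem volume_openCone_of_inner_eq (hn : 1 ≤ n) {u : E n} (hu : ‖u‖ = 1) {s : ℝ} (hs : 0 < s)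
    {B : Set (E n)} (hB : MeasurableSet B) (hBs : ∀ b ∈ B, ⟪b, u⟫ = s) :
    volume (openCone B) = ENNReal.ofReal (s / n) *
      (Measure.euclideanHausdorffMeasure (n - 1) : Measure (E n)) B := by
  have hmeas : MeasurableSet (openCone B) := by
    refine measurableSet_openCone hB (fun z => ⟪z, u⟫ / s) fun t _ y hy => ?_
    simp only [inner_smul_left, hBs y hy]
    simp [hs.ne']
  have hu0 : u ≠ 0 := by rintro rfl; simp at hu
  -- Fubini in the direction `u`: the slice of the cone at height x in (0, s) is the base scaled by
  -- x/s, so the volume is the area times ∫₀ˢ (x/s)^(n-1) dx = s/n.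
  have h := EuclideanGeometry.euclideanHausdorffMeasure_eq_lintegral (0 : E n) hu0 hmeas
  have hue : ‖u‖ₑ = 1 := by rw [← ofReal_norm, hu, ENNReal.ofReal_one]
  rw [finrank_euclideanSpace_fin, ← volume_eq_euclideanHausdorffMeasure, hue, one_mul] at h
  rw [h]
  have hmem : ∀ (x : ℝ) (z : E n),
      z ∈ AffineSubspace.mk' (x • u +ᵥ (0 : E n)) (ℝ ∙ u)ᗮ ↔ ⟪z, u⟫ = x := by
    intro x z
    rw [AffineSubspace.mem_mk', Submodule.mem_orthogonal_singleton_iff_inner_left]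
    simp only [vadd_eq_add, add_zero, vsub_eq_sub, inner_sub_left, inner_smul_left,
      real_inner_self_eq_norm_sq, hu]
    simp [sub_eq_zero]
  have hslice : ∀ x : ℝ, (Measure.euclideanHausdorffMeasure (n - 1) : Measure (E n))
      (openCone B ∩ AffineSubspace.mk' (x • u +ᵥ (0 : E n)) (ℝ ∙ u)ᗮ) =
      (Ioo 0 s).indicator (fun x => ENNReal.ofReal ((x / s) ^ (n - 1)) *
        (Measure.euclideanHausdorffMeasure (n - 1) : Measure (E n)) B) x := by
    intro x
    by_cases hx : x ∈ Ioo 0 s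
    · rw [indicator_of_mem hx]
      have hxs : 0 < x / s := div_pos hx.1 hs
      have : openCone B ∩ (AffineSubspace.mk' (x • u +ᵥ (0 : E n)) (ℝ ∙ u)ᗮ : Set (E n)) =
          (x / s) • B := by
        ext z
        simp only [mem_inter_iff, SetLike.mem_coe, hmem]
        constructor
        · rintro ⟨⟨⟨t, y⟩, ⟨ht, hy⟩, rfl⟩, hz⟩
          simp only [inner_smul_left, hBs y hy] at hz
          refine ⟨y, hy, ?_⟩
          have : x / s = t := by rw [← hz]; simp [hs.ne']
          simp [this]
        · rintro ⟨y, hy, rfl⟩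
          refine ⟨⟨(x / s, y), ⟨⟨hxs, (div_lt_one hs).2 hx.2⟩, hy⟩, rfl⟩, ?_⟩
          simp [inner_smul_left, hBs y hy, hs.ne']
      rw [this, Measure.euclideanHausdorffMeasure_smul₀ _ hxs.ne', ENNReal.smul_def, smul_eq_mul]
      congr 1
      rw [ENNReal.ofReal_pow hxs.le, ← Real.enorm_of_nonneg hxs.le, ENNReal.coe_pow]
      rfl
    · rw [indicator_of_notMem hx]
      convert measure_empty (μ := (Measure.euclideanHausdorffMeasure (n - 1) : Measure (E n)))
      ext z
      simp only [mem_inter_iff, SetLike.mem_coe, hmem, mem_empty_iff_false, iff_false, not_and]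
      rintro ⟨⟨t, y⟩, ⟨ht, hy⟩, rfl⟩ hz
      simp only [inner_smul_left, hBs y hy] at hz
      apply hx
      rw [← hz]
      simp only [conj_trivial]
      exact ⟨mul_pos ht.1 hs, by nlinarith [ht.2]⟩
  simp_rw [hslice]
  rw [lintegral_indicator measurableSet_Ioo, lintegral_mul_const _ (by fun_prop)]
  congr 1
  rw [← ofReal_integral_eq_lintegral_ofReal, ← integral_Ioc_eq_integral_Ioo,
    ← intervalIntegral.integral_of_le hs.le]
  · congr 1
    simp_rw [div_pow]
    rw [intervalIntegral.integral_div, integral_pow]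
    obtain ⟨m, rfl⟩ : ∃ m, n = m + 1 := ⟨n - 1, by omega⟩
    simp only [Nat.add_sub_cancel]
    push_cast
    field_simp
    simp [pow_succ]
  · exact (Continuous.integrableOn_Icc (by fun_prop)).mono_set Ioo_subset_Icc_self
  · filter_upwards [ae_restrict_mem measurableSet_Ioo] with x hx
    exact pow_nonneg (div_nonneg hx.1.le hs.le) _

/-- Moving `y` along `u` onto the hyperplane at height `s` changes differences of cone points only
in the direction `u`. The change is small relative to the flat difference `D`, because `D` controls
both the radial parameter and the scaled displacement of the base points. This makes the map between
the two cones nearly isometric. -/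
theorem inner_smul_sub_smul_bound {u y y' : E n} {r R δ s t t' : ℝ} (hu : ‖u‖ = 1)
    (hr : 0 < r) (hrs : r ≤ s) (hδ : 0 ≤ δ) (hδ' : δ ≤ 1 / 2) (hyR : ‖y‖ ≤ R)
    (hy : |⟪y, u⟫ - s| ≤ δ) (hyy' : |⟪y - y', u⟫| ≤ δ * ‖y - y'‖) (ht' : 0 ≤ t') :
    ‖t • y - t' • y' - (t • (y + (s - ⟪y, u⟫) • u) - t' • (y' + (s - ⟪y', u⟫) • u))‖ ≤
      δ * (2 + (2 * R + 3) / r) *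
        ‖t • (y + (s - ⟪y, u⟫) • u) - t' • (y' + (s - ⟪y', u⟫) • u)‖ := by
  set b := y + (s - ⟪y, u⟫) • u with hb
  set b' := y' + (s - ⟪y', u⟫) • u with hb'
  have huu : ⟪u, u⟫ = (1 : ℝ) := by rw [real_inner_self_eq_norm_sq, hu]; norm_num
  have hbs : ⟪b, u⟫ = s := by simp [hb, inner_add_left, inner_smul_left, hu]
  have hbs' : ⟪b', u⟫ = s := by simp [hb', inner_add_left, inner_smul_left, hu]
  set D := ‖t • b - t' • b'‖
  have hD : 0 ≤ D := norm_nonneg _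
  -- Flattened points all have height `s`, so the component of the difference along `u` is (t -
  -- t')s, and s ≥ r.
  have htt : |t - t'| ≤ D / r := by
    rw [le_div_iff₀ hr]
    have h1 : |⟪t • b - t' • b', u⟫| ≤ D := by
      simpa [hu] using abs_real_inner_le_norm (t • b - t' • b') u
    have h2 : ⟪t • b - t' • b', u⟫ = (t - t') * s := by
      simp [inner_sub_left, inner_smul_left, hbs, hbs']; ring
    rw [h2, abs_mul, abs_of_pos (hr.trans_le hrs)] at h1
    exact (mul_le_mul_of_nonneg_left hrs (abs_nonneg _)).trans h1
  have hnb : ‖b‖ ≤ R + 1 := by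
    have : ‖(s - ⟪y, u⟫) • u‖ ≤ δ := by
      rw [norm_smul, hu, mul_one, Real.norm_eq_abs, abs_sub_comm]; exact hy
    calc ‖b‖ ≤ ‖y‖ + ‖(s - ⟪y, u⟫) • u‖ := norm_add_le _ _
      _ ≤ R + 1 := by linarith
  have hyb : ‖y - y'‖ ≤ 2 * ‖b - b'‖ := by
    have h1 : y - y' = (b - b') + ⟪y - y', u⟫ • u := by
      rw [hb, hb', inner_sub_left]; module
    have h2 : ‖y - y'‖ ≤ ‖b - b'‖ + δ * ‖y - y'‖ := by
      calc ‖y - y'‖ = ‖(b - b') + ⟪y - y', u⟫ • u‖ := by rw [← h1]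
        _ ≤ ‖b - b'‖ + ‖⟪y - y', u⟫ • u‖ := norm_add_le _ _
        _ ≤ _ := by
          rw [norm_smul, hu, mul_one, Real.norm_eq_abs]; gcongr
    nlinarith [norm_nonneg (y - y')]
  have htb : t' * ‖b - b'‖ ≤ D + D / r * (R + 1) := by
    have h1 : t' • (b - b') = (t • b - t' • b') - (t - t') • b := by module
    calc t' * ‖b - b'‖ = ‖t' • (b - b')‖ := by
          rw [norm_smul, Real.norm_of_nonneg ht']
      _ ≤ D + ‖(t - t') • b‖ := by rw [h1]; exact norm_sub_le _ _
      _ ≤ D + D / r * (R + 1) := by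
        rw [norm_smul, Real.norm_eq_abs]; gcongr
  have he : t • y - t' • y' - (t • b - t' • b') =
      ((t - t') * (⟪y, u⟫ - s) + t' * ⟪y - y', u⟫) • u := by
    rw [hb, hb', inner_sub_left]; module
  rw [he, norm_smul, hu, mul_one, Real.norm_eq_abs]
  calc |(t - t') * (⟪y, u⟫ - s) + t' * ⟪y - y', u⟫|
      ≤ |t - t'| * |⟪y, u⟫ - s| + t' * |⟪y - y', u⟫| := by
        refine (abs_add_le _ _).trans ?_
        rw [abs_mul, abs_mul, abs_of_nonneg ht']
    _ ≤ D / r * δ + t' * (δ * (2 * ‖b - b'‖)) := by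
        gcongr
        exact hyy'.trans (by gcongr)
    _ = D / r * δ + 2 * δ * (t' * ‖b - b'‖) := by ring
    _ ≤ D / r * δ + 2 * δ * (D + D / r * (R + 1)) := by gcongr
    _ = _ := by ring

/-- A set which is nearly flat in the direction orthogonal to `u` has a cone whose volume is
nearly that of the cone over a flat set. -/
theorem volume_openCone_compare (hn : 1 ≤ n) {u : E n} {r R δ κ s : ℝ} {L : ℝ≥0} (hu : ‖u‖ = 1)
    (hr : 0 < r) (hrs : r ≤ s) (hR : 0 ≤ R) (hδ : 0 ≤ δ)
    (hκ : δ * (2 + (2 * R + 3) / r) ≤ κ) (hκ' : κ ≤ 1 / 2) (hL : 1 + 2 * κ ≤ L)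
    {A : Set (E n)} (hA : MeasurableSet A) (hAR : ∀ y ∈ A, ‖y‖ ≤ R)
    (hAs : ∀ y ∈ A, |⟪y, u⟫ - s| ≤ δ)
    (hAA : ∀ y ∈ A, ∀ y' ∈ A, |⟪y - y', u⟫| ≤ δ * ‖y - y'‖) :
    volume (openCone A) ≤ (L : ℝ≥0∞) ^ (2 * n) * (ENNReal.ofReal (s / n) *
      (Measure.euclideanHausdorffMeasure (n - 1) : Measure (E n)) A) ∧
    ENNReal.ofReal (s / n) * (Measure.euclideanHausdorffMeasure (n - 1) : Measure (E n)) A ≤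
      (L : ℝ≥0∞) ^ (2 * n) * volume (openCone A) := by
  have hC : 2 ≤ 2 + (2 * R + 3) / r := by
    have : 0 ≤ (2 * R + 3) / r := by positivity
    linarith
  have hδκ : 2 * δ ≤ κ := by nlinarith
  have hκ0 : 0 ≤ κ := by linarith
  have huu : ⟪u, u⟫ = (1 : ℝ) := by rw [real_inner_self_eq_norm_sq, hu]; norm_num
  have hL1 : (1 : ℝ≥0∞) ≤ L := by
    have : (1 : ℝ) ≤ L := by linarith
    exact_mod_cast this
  set b : E n → E n := fun y => y + (s - ⟪y, u⟫) • u with hb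
  have hbs : ∀ y, ⟪b y, u⟫ = s := fun y => by
    simp [hb, inner_add_left, inner_smul_left, hu]
  have hbb : ∀ y y', b y - b y' = (y - y') - ⟪y - y', u⟫ • u := fun y y' => by
    simp only [hb, inner_sub_left]; module
  have hedist : ∀ {x x' z z' : E n}, ‖x - x'‖ ≤ L * ‖z - z'‖ →
      edist x x' ≤ L * edist z z' := by
    intro x x' z z' h
    rw [edist_dist, edist_dist, dist_eq_norm, dist_eq_norm]
    calc _ ≤ ENNReal.ofReal (L * ‖z - z'‖) := ENNReal.ofReal_le_ofReal h
      _ = _ := by rw [ENNReal.ofReal_mul L.coe_nonneg, ENNReal.ofReal_coe_nnreal]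
  -- The map `b` is an orthogonal projection onto a hyperplane, hence nonexpansive.
  have hba : ∀ y ∈ A, ∀ y' ∈ A, ‖b y - b y'‖ ≤ ‖y - y'‖ := by
    intro y _ y' _
    rw [hbb]
    refine (sq_le_sq₀ (norm_nonneg _) (norm_nonneg _)).1 ?_
    rw [norm_sub_sq_real, inner_smul_right, norm_smul, hu, Real.norm_eq_abs, mul_one, sq_abs]
    nlinarith [sq_nonneg ⟪y - y', u⟫]
  have hab : ∀ y ∈ A, ∀ y' ∈ A, ‖y - y'‖ ≤ L * ‖b y - b y'‖ := by
    intro y hy y' hy'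
    have h1 : y - y' = (b y - b y') + ⟪y - y', u⟫ • u := by rw [hbb]; module
    have h2 : ‖y - y'‖ ≤ ‖b y - b y'‖ + δ * ‖y - y'‖ := by
      calc ‖y - y'‖ = ‖(b y - b y') + ⟪y - y', u⟫ • u‖ := by rw [← h1]
        _ ≤ ‖b y - b y'‖ + ‖⟪y - y', u⟫ • u‖ := norm_add_le _ _
        _ ≤ _ := by
          rw [norm_smul, hu, mul_one, Real.norm_eq_abs]
          gcongr
          exact hAA y hy y' hy'
    have h3 : ‖y - y'‖ ≤ (1 + 2 * κ) * ‖b y - b y'‖ := by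
      have h4 : (1 - δ) * ‖y - y'‖ ≤ ‖b y - b y'‖ := by linarith
      have h5 : 1 ≤ (1 + 2 * κ) * (1 - δ) := by nlinarith
      calc ‖y - y'‖ ≤ ((1 + 2 * κ) * (1 - δ)) * ‖y - y'‖ :=
            le_mul_of_one_le_left (norm_nonneg _) h5
        _ = (1 + 2 * κ) * ((1 - δ) * ‖y - y'‖) := by ring
        _ ≤ _ := by gcongr
    exact h3.trans (by gcongr)
  have hBm : MeasurableSet (b '' A) := by
    refine hA.image_of_continuousOn_injOn (by fun_prop) fun y hy y' hy' h => ?_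
    have := hab y hy y' hy'
    rw [h, sub_self, norm_zero, mul_zero] at this
    exact sub_eq_zero.1 (norm_le_zero_iff.1 this)
  have hflat := volume_openCone_of_inner_eq hn hu (hr.trans_le hrs) hBm
    (by rintro _ ⟨y, -, rfl⟩; exact hbs y)
  have hH1 : (Measure.euclideanHausdorffMeasure (n - 1) : Measure (E n)) (b '' A) ≤
      (Measure.euclideanHausdorffMeasure (n - 1) : Measure (E n)) A := by
    have := euclideanHausdorffMeasure_image_le_image b id A 1 (fun y hy y' hy' => by
      rw [edist_dist, edist_dist, dist_eq_norm, dist_eq_norm, ENNReal.coe_one, one_mul]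
      exact ENNReal.ofReal_le_ofReal (hba y hy y' hy')) (n - 1)
    simpa using this
  have hH2 : (Measure.euclideanHausdorffMeasure (n - 1) : Measure (E n)) A ≤
      (L : ℝ≥0∞) ^ (n - 1) *
        (Measure.euclideanHausdorffMeasure (n - 1) : Measure (E n)) (b '' A) := by
    have := euclideanHausdorffMeasure_image_le_image id b A L
      (fun y hy y' hy' => hedist (hab y hy y' hy')) (n - 1)
    simpa using this
  have hcone : openCone (b '' A) = (fun z : ℝ × E n => z.1 • b z.2) '' (Ioo 0 1 ×ˢ A) := by
    ext z
    constructor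
    · rintro ⟨⟨t, _⟩, ⟨ht, y, hy, rfl⟩, rfl⟩
      exact ⟨(t, y), ⟨ht, hy⟩, rfl⟩
    · rintro ⟨⟨t, y⟩, ⟨ht, hy⟩, rfl⟩
      exact ⟨(t, b y), ⟨ht, y, hy, rfl⟩, rfl⟩
  have hest : ∀ i ∈ (Ioo (0 : ℝ) 1 ×ˢ A), ∀ j ∈ (Ioo (0 : ℝ) 1 ×ˢ A),
      ‖i.1 • i.2 - j.1 • j.2 - (i.1 • b i.2 - j.1 • b j.2)‖ ≤
        κ * ‖i.1 • b i.2 - j.1 • b j.2‖ := by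
    rintro ⟨t, y⟩ ⟨-, hy⟩ ⟨t', y'⟩ ⟨ht', hy'⟩
    refine (inner_smul_sub_smul_bound hu hr hrs hδ (by linarith) (hAR y hy) (hAs y hy)
      (hAA y hy y' hy') ht'.1.le).trans ?_
    gcongr
  have hV1 : volume (openCone A) ≤ (L : ℝ≥0∞) ^ n * volume (openCone (b '' A)) := by
    rw [hcone, volume_eq_euclideanHausdorffMeasure]
    refine euclideanHausdorffMeasure_image_le_image _ _ _ L (fun i hi j hj => hedist ?_) n
    have h := hest i hi j hj
    have h2 := norm_sub_norm_le (i.1 • i.2 - j.1 • j.2) (i.1 • b i.2 - j.1 • b j.2)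
    have h3 : (1 + 2 * κ) * ‖i.1 • b i.2 - j.1 • b j.2‖ ≤ L * ‖i.1 • b i.2 - j.1 • b j.2‖ := by
      gcongr
    nlinarith [norm_nonneg (i.1 • b i.2 - j.1 • b j.2)]
  have hV2 : volume (openCone (b '' A)) ≤ (L : ℝ≥0∞) ^ n * volume (openCone A) := by
    rw [hcone, volume_eq_euclideanHausdorffMeasure]
    refine euclideanHausdorffMeasure_image_le_image _ _ _ L (fun i hi j hj => hedist ?_) n
    have h := hest i hi j hj
    rw [norm_sub_rev] at h
    have h2 := norm_sub_norm_le (i.1 • b i.2 - j.1 • b j.2) (i.1 • i.2 - j.1 • j.2)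
    set X := ‖i.1 • b i.2 - j.1 • b j.2‖
    set Y := ‖i.1 • i.2 - j.1 • j.2‖
    have hX : 0 ≤ X := norm_nonneg _
    have hY : 0 ≤ Y := norm_nonneg _
    have h3 : (1 + 2 * κ) * Y ≤ L * Y := by gcongr
    have h4 : (1 - κ) * X ≤ Y := by linarith
    -- The excess is κ(1 - 2κ), which is where κ ≤ 1/2 enters.
    have h5 : 1 ≤ (1 + 2 * κ) * (1 - κ) := by nlinarith
    have h6 : X ≤ ((1 + 2 * κ) * (1 - κ)) * X := le_mul_of_one_le_left hX h5
    have h7 : (1 + 2 * κ) * ((1 - κ) * X) ≤ (1 + 2 * κ) * Y := by gcongr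
    change X ≤ L * Y
    linarith
  -- The losses are `L ^ n` one way and `L ^ (2 * n - 1)` the other; `2 * n` is a common bound.
  constructor
  · calc volume (openCone A) ≤ (L : ℝ≥0∞) ^ n * volume (openCone (b '' A)) := hV1
      _ ≤ (L : ℝ≥0∞) ^ (2 * n) * volume (openCone (b '' A)) := by
        gcongr ?_ * _
        exact pow_le_pow_right₀ hL1 (by omega)
      _ ≤ _ := by rw [hflat]; gcongr
  · calc _ ≤ ENNReal.ofReal (s / n) * ((L : ℝ≥0∞) ^ (n - 1) *
          (Measure.euclideanHausdorffMeasure (n - 1) : Measure (E n)) (b '' A)) := by gcongr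
      _ = (L : ℝ≥0∞) ^ (n - 1) * volume (openCone (b '' A)) := by rw [hflat]; ring
      _ ≤ (L : ℝ≥0∞) ^ (n - 1) * ((L : ℝ≥0∞) ^ n * volume (openCone A)) := by gcongr
      _ = (L : ℝ≥0∞) ^ (n - 1 + n) * volume (openCone A) := by ring
      _ ≤ _ := by
        gcongr ?_ * _
        exact pow_le_pow_right₀ hL1 (by omega)

/-! ### Support functions, gauges and outer normals -/

theorem exists_closedBall_subset {K : ConvexBody (E n)} (hK : K ∈ K0 n) :
    ∃ r > 0, Metric.closedBall (0 : E n) r ⊆ K := by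
  have h : (K : Set (E n)) ∈ 𝓝 (0 : E n) := mem_interior_iff_mem_nhds.1 hK
  obtain ⟨ε, hε, h⟩ := Metric.nhds_basis_closedBall.mem_iff.1 h
  exact ⟨ε, hε, h⟩

theorem exists_norm_le (K : ConvexBody (E n)) : ∃ R > 0, ∀ x ∈ K, ‖x‖ ≤ R :=
  K.isBounded.exists_pos_norm_le

theorem bddAbove_inner_image (K : ConvexBody (E n)) (u : E n) :
    BddAbove ((fun x : E n => ⟪x, u⟫) '' (K : Set (E n))) :=
  (K.isCompact.image (by fun_prop)).bddAbove

theorem inner_le_supportFn {K : ConvexBody (E n)} {x : E n} (hx : x ∈ K) (u : E n) :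
    ⟪x, u⟫ ≤ supportFn K u :=
  le_csSup (bddAbove_inner_image K u) ⟨x, hx, rfl⟩

theorem supportFn_le {K : ConvexBody (E n)} {u : E n} {c : ℝ} (h : ∀ x ∈ K, ⟪x, u⟫ ≤ c) :
    supportFn K u ≤ c := by
  refine csSup_le (K.nonempty.image _) ?_
  rintro _ ⟨x, hx, rfl⟩
  exact h x hx

theorem IsOuterNormal.supportFn_eq {K : ConvexBody (E n)} {x : E n} {u : S n} (hx : x ∈ K)
    (h : IsOuterNormal K x u) : supportFn K u = ⟪x, (u : E n)⟫ :=
  le_antisymm (supportFn_le h) (inner_le_supportFn hx _)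

theorem supportFn_le_add {K : ConvexBody (E n)} {R : ℝ} (hR : ∀ x ∈ K, ‖x‖ ≤ R) (u v : E n) :
    supportFn K u ≤ supportFn K v + R * ‖u - v‖ := by
  refine supportFn_le fun x hx => ?_
  have h1 : ⟪x, u⟫ = ⟪x, v⟫ + ⟪x, u - v⟫ := by rw [inner_sub_right]; ring
  rw [h1]
  refine add_le_add (inner_le_supportFn hx v) ((real_inner_le_norm _ _).trans ?_)
  gcongr
  exact hR x hx

theorem continuous_supportFn (K : ConvexBody (E n)) : Continuous (supportFn K) := by
  obtain ⟨R, hR0, hR⟩ := exists_norm_le K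
  refine (LipschitzWith.of_le_add_mul R.toNNReal fun u v => ?_).continuous
  rw [Real.coe_toNNReal _ hR0.le, dist_eq_norm]
  exact supportFn_le_add hR u v

theorem le_supportFn {K : ConvexBody (E n)} {r : ℝ} (hr : 0 ≤ r)
    (h : Metric.closedBall (0 : E n) r ⊆ K) (u : S n) : r ≤ supportFn K u := by
  have hu : ‖(u : E n)‖ = 1 := norm_eq_of_mem_sphere u
  have hx : r • (u : E n) ∈ K := by
    apply h
    simp [norm_smul, hu, abs_of_nonneg hr]
  have := inner_le_supportFn hx (u : E n)
  rwa [inner_smul_left, real_inner_self_eq_norm_sq, hu, one_pow, mul_one] at this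

theorem supportFn_pos {K : ConvexBody (E n)} (hK : K ∈ K0 n) (u : S n) : 0 < supportFn K u := by
  obtain ⟨r, hr, h⟩ := exists_closedBall_subset hK
  exact hr.trans_le (le_supportFn hr.le h u)

theorem mem_nhds_zero {K : ConvexBody (E n)} (hK : K ∈ K0 n) : (K : Set (E n)) ∈ 𝓝 (0 : E n) :=
  mem_interior_iff_mem_nhds.1 hK

theorem gauge_eq_one {K : ConvexBody (E n)} (hK : K ∈ K0 n) {x : E n}
    (hx : x ∈ frontier (K : Set (E n))) : gauge (K : Set (E n)) x = 1 :=
  (gauge_eq_one_iff_mem_frontier K.convex (mem_nhds_zero hK)).2 hx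

theorem mem_of_mem_frontier {K : ConvexBody (E n)} {x : E n}
    (hx : x ∈ frontier (K : Set (E n))) : x ∈ K :=
  K.isClosed.frontier_subset hx

/-- Every boundary point has an outer unit normal. -/
theorem exists_isOuterNormal {K : ConvexBody (E n)} (hK : K ∈ K0 n) {x : E n}
    (hx : x ∈ frontier (K : Set (E n))) : ∃ u : S n, IsOuterNormal K x u := by
  have hxi : x ∉ interior (K : Set (E n)) := by
    rw [frontier_eq_closure_inter_closure] at hx
    rw [← mem_compl_iff, ← closure_compl]
    exact hx.2
  obtain ⟨f, hf⟩ := geometric_hahn_banach_open_point K.convex.interior isOpen_interior hxi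
  set v := (InnerProductSpace.toDual ℝ (E n)).symm f with hv
  have hfv : ∀ y, f y = ⟪y, v⟫ := fun y => by
    rw [real_inner_comm, hv, InnerProductSpace.toDual_symm_apply]
  have hv0 : v ≠ 0 := by
    intro h0
    have := hf 0 hK
    rw [hfv, hfv, h0] at this
    simp at this
  have hle : ∀ y ∈ K, ⟪y, v⟫ ≤ ⟪x, v⟫ := by
    intro y hy
    have hcl : (K : Set (E n)) ⊆ closure (interior (K : Set (E n))) := by
      rw [K.convex.closure_interior_eq_closure_of_nonempty_interior ⟨0, hK⟩]
      exact subset_closure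
    have : closure (interior (K : Set (E n))) ⊆ {y | ⟪y, v⟫ ≤ ⟪x, v⟫} := by
      refine closure_minimal (fun z hz => ?_) (isClosed_le (by fun_prop) (by fun_prop))
      have := hf z hz
      rw [hfv, hfv] at this
      exact this.le
    exact this (hcl hy)
  refine ⟨⟨‖v‖⁻¹ • v, by simp [norm_smul, hv0]⟩, fun y hy => ?_⟩
  simp only [inner_smul_right]
  exact mul_le_mul_of_nonneg_left (hle y hy) (by positivity)

/-- Scaling `y` by the inverse of its gauge puts it in `K`, where the normal inequality applies.
When `x` is a boundary point, equality holds along its ray, which makes the ray a set of minima in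
the next lemma. -/
theorem IsOuterNormal.inner_le_gauge {K : ConvexBody (E n)} (hK : K ∈ K0 n) {x : E n} {u : S n}
    (h : IsOuterNormal K x u) (y : E n) :
    ⟪y, (u : E n)⟫ ≤ ⟪x, (u : E n)⟫ * gauge (K : Set (E n)) y := by
  have habs := absorbent_nhds_zero (𝕜 := ℝ) (mem_nhds_zero hK)
  have hb := (NormedSpace.isVonNBounded_iff ℝ).2 K.isBounded
  rcases eq_or_ne y 0 with rfl | hy
  · simp
  have hg : 0 < gauge (K : Set (E n)) y := (gauge_pos habs hb).2 hy
  have hmem : (gauge (K : Set (E n)) y)⁻¹ • y ∈ K := by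
    have : gauge (K : Set (E n)) ((gauge (K : Set (E n)) y)⁻¹ • y) ≤ 1 := by
      rw [gauge_smul_of_nonneg (by positivity), smul_eq_mul, inv_mul_cancel₀ hg.ne']
    have := (gauge_le_one_iff_mem_closure K.convex (mem_nhds_zero hK)).1 this
    rwa [K.isClosed.closure_eq] at this
  have := h _ hmem
  rw [inner_smul_left] at this
  simp only [conj_trivial] at this
  rwa [inv_mul_le_iff₀ hg, mul_comm] at this

/-- The gauge of `K` is not differentiable along the rays through boundary points having
several outer normals. -/
theorem IsOuterNormal.unique_of_differentiableAt {K : ConvexBody (E n)} (hK : K ∈ K0 n) {x : E n}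
    (hx : x ∈ frontier (K : Set (E n))) {t : ℝ} (ht : 0 < t)
    (hd : DifferentiableAt ℝ (gauge (K : Set (E n))) (t • x)) {u v : S n}
    (hu : IsOuterNormal K x u) (hv : IsOuterNormal K x v) : u = v := by
  have key : ∀ w : S n, IsOuterNormal K x w →
      0 < ⟪x, (w : E n)⟫ ∧ ∀ y, ⟪y, (w : E n)⟫ =
        ⟪x, (w : E n)⟫ * fderiv ℝ (gauge (K : Set (E n))) (t • x) y := by
    intro w hw
    refine ⟨by rw [← hw.supportFn_eq (mem_of_mem_frontier hx)]; exact supportFn_pos hK w,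
      fun y => ?_⟩
    have hmin : IsLocalMin (fun y : E n => ⟪x, (w : E n)⟫ * gauge (K : Set (E n)) y -
        innerSL ℝ (w : E n) y) (t • x) := by
      refine Filter.Eventually.of_forall fun y => ?_
      have h1 := hw.inner_le_gauge hK y
      simp only [innerSL_apply_apply]
      rw [real_inner_comm y, real_inner_comm (t • x), inner_smul_left,
        gauge_smul_of_nonneg ht.le, gauge_eq_one hK hx]
      simp only [conj_trivial, smul_eq_mul]
      linarith
    have hfd := (hd.hasFDerivAt.const_mul ⟪x, (w : E n)⟫).sub
      (innerSL ℝ (w : E n)).hasFDerivAt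
    have h0 := hmin.hasFDerivAt_eq_zero hfd
    have := congrArg (fun L : E n →L[ℝ] ℝ => L y) h0
    simp only [sub_apply, smul_apply, smul_eq_mul,
      zero_apply, innerSL_apply_apply] at this
    rw [real_inner_comm y] at this
    linarith
  obtain ⟨hu0, hu'⟩ := key u hu
  obtain ⟨hv0, hv'⟩ := key v hv
  set a := ⟪x, (u : E n)⟫
  set b := ⟪x, (v : E n)⟫
  -- Both normals are positive multiples of the one gradient of the gauge, and both have length one.
  have huv : b • (u : E n) = a • (v : E n) := by
    refine ext_inner_left ℝ fun y => ?_
    rw [inner_smul_right, inner_smul_right, hu', hv']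
    ring
  have hnu : ‖(u : E n)‖ = 1 := norm_eq_of_mem_sphere u
  have hnv : ‖(v : E n)‖ = 1 := norm_eq_of_mem_sphere v
  have hab : b = a := by
    have := congrArg norm huv
    rwa [norm_smul, norm_smul, hnu, hnv, mul_one, mul_one, Real.norm_of_nonneg hv0.le,
      Real.norm_of_nonneg hu0.le] at this
  rw [hab] at huv
  exact Subtype.ext (smul_right_injective _ hu0.ne' huv)

/-! ### Cones over the regular boundary -/

theorem openCone_subset {K : ConvexBody (E n)} (hK : K ∈ K0 n) {A : Set (E n)}
    (hA : A ⊆ frontier (K : Set (E n))) : openCone A ⊆ K := by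
  rintro _ ⟨⟨t, y⟩, ⟨ht, hy⟩, rfl⟩
  have h0 : (0 : E n) ∈ K := interior_subset hK
  exact K.convex.smul_mem_of_zero_mem h0 (mem_of_mem_frontier (hA hy)) ⟨ht.1.le, ht.2.le⟩

/-- The cone over the regular boundary fills `K` up to a null set. -/
theorem volume_openCone_regularBoundary (hn : 1 ≤ n) {K : ConvexBody (E n)} (hK : K ∈ K0 n) :
    volume (openCone (regularBoundary K)) = volume (K : Set (E n)) := by
  refine le_antisymm (measure_mono (openCone_subset hK fun x hx => hx.1)) ?_
  refine measure_mono_ae ?_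
  have : Nonempty (Fin n) := ⟨⟨0, hn⟩⟩
  have habs := absorbent_nhds_zero (𝕜 := ℝ) (mem_nhds_zero hK)
  have hb := (NormedSpace.isVonNBounded_iff ℝ).2 K.isBounded
  obtain ⟨C, hC⟩ := K.convex.lipschitz_gauge (mem_nhds_zero hK)
  have h0 : ∀ᵐ z : E n, z ≠ 0 := by simp [ae_iff]
  have hfr : ∀ᵐ z : E n, z ∉ frontier (K : Set (E n)) :=
    measure_eq_zero_iff_ae_notMem.1 (K.convex.addHaar_frontier volume)
  -- Rademacher's theorem: at almost every point of `K` the gauge is differentiable, so the radial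
  -- projection to the boundary is a regular point.
  filter_upwards [hC.ae_differentiableAt (μ := volume), h0, hfr] with z hd hz0 hzf hzK
  have hg : 0 < gauge (K : Set (E n)) z := (gauge_pos habs hb).2 hz0
  have hg1 : gauge (K : Set (E n)) z < 1 := by
    refine lt_of_le_of_ne (gauge_le_one_of_mem hzK) fun h => hzf ?_
    exact (gauge_eq_one_iff_mem_frontier K.convex (mem_nhds_zero hK)).1 h
  set g := gauge (K : Set (E n)) z
  have hx : g⁻¹ • z ∈ frontier (K : Set (E n)) := by
    rw [← gauge_eq_one_iff_mem_frontier K.convex (mem_nhds_zero hK),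
      gauge_smul_of_nonneg (by positivity), smul_eq_mul, inv_mul_cancel₀ hg.ne']
  have hgz : g • g⁻¹ • z = z := smul_inv_smul₀ hg.ne' z
  obtain ⟨u, hu⟩ := exists_isOuterNormal hK hx
  refine ⟨(g, g⁻¹ • z), ⟨⟨hg, hg1⟩, hx, u, hu, fun v hv => ?_⟩, hgz⟩
  exact IsOuterNormal.unique_of_differentiableAt hK hx hg (by rwa [hgz]) hv hu

/-- The regular boundary points whose outer unit normal lies in `U`. -/
def regularBoundaryOver (K : ConvexBody (E n)) (U : Set (S n)) : Set (E n) :=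
  {x : E n | x ∈ regularBoundary K ∧ ∃ u ∈ U, IsOuterNormal K x u}

theorem measurableSet_regularBoundaryOver (K : ConvexBody (E n)) {U : Set (S n)}
    (hU : MeasurableSet U) : MeasurableSet (regularBoundaryOver K U) := by
  have : regularBoundaryOver K U = Subtype.val '' (gaussMap K ⁻¹' U) := by
    rw [gaussMap_preimage, Subtype.image_preimage_coe]
    rfl
  rw [this]
  exact (measurableSet_regularBoundary K).subtype_image (measurable_gaussMap K hU)

theorem measurableSet_openCone_regularBoundaryOver {K : ConvexBody (E n)} (hK : K ∈ K0 n)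
    {U : Set (S n)} (hU : MeasurableSet U) :
    MeasurableSet (openCone (regularBoundaryOver K U)) := by
  refine measurableSet_openCone (measurableSet_regularBoundaryOver K hU)
    (gauge (K : Set (E n))) fun t ht y hy => ?_
  rw [gauge_smul_of_nonneg ht.le, gauge_eq_one hK hy.1.1, smul_eq_mul, mul_one]

theorem disjoint_openCone_regularBoundaryOver {K : ConvexBody (E n)} (hK : K ∈ K0 n)
    {U V : Set (S n)} (hUV : Disjoint U V) :
    Disjoint (openCone (regularBoundaryOver K U)) (openCone (regularBoundaryOver K V)) := by
  rw [Set.disjoint_left]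
  rintro _ ⟨⟨t, y⟩, ⟨ht, hy, u, hu, hyu⟩, rfl⟩ ⟨⟨t', y'⟩, ⟨ht', hy', v, hv, hyv⟩, h⟩
  simp only at h ht ht' hy hy' hyu hyv
  have h1 : t' = t := by
    have := congrArg (gauge (K : Set (E n))) h
    rwa [gauge_smul_of_nonneg ht.1.le, gauge_eq_one hK hy.1, gauge_smul_of_nonneg ht'.1.le,
      gauge_eq_one hK hy'.1, smul_eq_mul, smul_eq_mul, mul_one, mul_one] at this
  subst h1
  have h2 : y' = y := smul_right_injective _ ht.1.ne' h
  subst h2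
  exact Set.disjoint_left.1 hUV hu (by rw [hy.2.unique hyu hyv]; exact hv)

/-! ### The cone-volume formula -/

/-- The cone-volume measure `dV_K = (1/n) h_K dS(K, ·)` on the sphere. -/
def coneVolumeMeasure (K : ConvexBody (E n)) : Measure (S n) :=
  (n : ℝ≥0∞)⁻¹ • (surfaceAreaMeasure K).withDensity (fun u => ENNReal.ofReal (supportFn K u))

theorem coneVolumeMeasure_apply (K : ConvexBody (E n)) {U : Set (S n)} (hU : MeasurableSet U) :
    coneVolumeMeasure K U =
      (n : ℝ≥0∞)⁻¹ * ∫⁻ u in U, ENNReal.ofReal (supportFn K u) ∂(surfaceAreaMeasure K) := by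
  rw [coneVolumeMeasure, Measure.smul_apply, withDensity_apply _ hU, smul_eq_mul]

/-- Each supporting hyperplane bounds the component of `y - y'` along its own normal from one side;
replacing that normal by `u` costs at most d‖y - y'‖. -/
theorem isOuterNormal_abs_inner_sub_le {K : ConvexBody (E n)} {y y' : E n} {v v' u : S n} {d : ℝ}
    (hy : y ∈ K) (hy' : y' ∈ K) (hv : IsOuterNormal K y v) (hv' : IsOuterNormal K y' v')
    (hvu : ‖(v : E n) - u‖ ≤ d) (hvu' : ‖(v' : E n) - u‖ ≤ d) :
    |⟪y - y', (u : E n)⟫| ≤ d * ‖y - y'‖ := by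
  have aux : ∀ (x x' : E n) (w : S n), x' ∈ K → IsOuterNormal K x w → ‖(w : E n) - u‖ ≤ d →
      ⟪x' - x, (u : E n)⟫ ≤ d * ‖x' - x‖ := by
    intro x x' w hx' hw hwu
    have h1 : ⟪x' - x, (w : E n)⟫ ≤ 0 := by
      rw [inner_sub_left]; linarith [hw x' hx']
    have h2 : ⟪x' - x, (u : E n)⟫ = ⟪x' - x, (w : E n)⟫ - ⟪x' - x, (w : E n) - u⟫ := by
      rw [inner_sub_right]; ring
    have h3 : |⟪x' - x, (w : E n) - u⟫| ≤ ‖x' - x‖ * d :=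
      (abs_real_inner_le_norm _ _).trans (by gcongr)
    rw [h2]
    linarith [neg_abs_le ⟪x' - x, (w : E n) - u⟫]
  rw [abs_le]
  have h1 := aux y' y v' hy hv' hvu'
  have h2 := aux y y' v hy' hv hvu
  rw [← neg_sub y y', inner_neg_left, norm_neg] at h2
  constructor <;> linarith

/-- Freezes a density at the constant `s` on a set where it stays within a factor 1 + κ of `s`. -/
theorem ofReal_mul_measure_compare {ν : Measure (S n)} {U : Set (S n)} (hU : MeasurableSet U)
    {h : S n → ℝ} (hh : Continuous h) {s κ : ℝ} (hs : 0 ≤ s) {L : ℝ≥0} (hL : 1 + κ ≤ L)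
    (h0 : ∀ u, 0 ≤ h u)
    (h1 : ∀ u ∈ U, h u ≤ (1 + κ) * s) (h2 : ∀ u ∈ U, s ≤ (1 + κ) * h u) :
    ENNReal.ofReal (s / n) * ν U ≤
      L * ((n : ℝ≥0∞)⁻¹ * ∫⁻ u in U, ENNReal.ofReal (h u) ∂ν) ∧
    (n : ℝ≥0∞)⁻¹ * ∫⁻ u in U, ENNReal.ofReal (h u) ∂ν ≤ L * (ENNReal.ofReal (s / n) * ν U) := by
  rcases Nat.eq_zero_or_pos n with rfl | hn
  · have : IsEmpty (S 0) := ⟨fun u => by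
      have := norm_eq_of_mem_sphere u
      rw [Subsingleton.elim (u : E 0) 0, norm_zero] at this
      exact zero_ne_one this⟩
    have : U = ∅ := Subsingleton.elim _ _
    simp [this]
  have hsn : ENNReal.ofReal (s / n) = (n : ℝ≥0∞)⁻¹ * ENNReal.ofReal s := by
    rw [ENNReal.ofReal_div_of_pos (by positivity), ENNReal.ofReal_natCast, mul_comm,
      ENNReal.div_eq_inv_mul, mul_comm]
  have hconst : ∫⁻ _ in U, ENNReal.ofReal s ∂ν = ENNReal.ofReal s * ν U := by simp
  have hLr : ∀ x : ℝ, L * ENNReal.ofReal x = ENNReal.ofReal (L * x) := fun x => by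
    rw [ENNReal.ofReal_mul L.coe_nonneg, ENNReal.ofReal_coe_nnreal]
  have hmeas : Measurable fun u => ENNReal.ofReal (h u) := by fun_prop
  constructor
  · rw [hsn, mul_assoc, ← hconst, mul_left_comm (L : ℝ≥0∞),
      ← lintegral_const_mul (L : ℝ≥0∞) hmeas]
    gcongr (n : ℝ≥0∞)⁻¹ * ?_
    refine setLIntegral_mono (hmeas.const_mul _) fun u hu => ?_
    rw [hLr]
    exact ENNReal.ofReal_le_ofReal ((h2 u hu).trans (by gcongr; exact h0 u))
  · rw [hsn, mul_assoc, ← hconst, mul_left_comm (L : ℝ≥0∞),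
      ← lintegral_const_mul (L : ℝ≥0∞) measurable_const]
    gcongr (n : ℝ≥0∞)⁻¹ * ?_
    refine setLIntegral_mono (measurable_const.const_mul _) fun u hu => ?_
    rw [hLr]
    exact ENNReal.ofReal_le_ofReal ((h1 u hu).trans (by gcongr))

/-- Normals close together make the boundary piece nearly flat and the support function nearly
constant. The first costs `L ^ (2 * n)`, the second one more factor `L`. The scale `d` does not
depend on `U`, so the estimates can be summed over a partition. -/
theorem exists_volume_openCone_compare_coneVolumeMeasure (hn : 1 ≤ n) {K : ConvexBody (E n)}
    (hK : K ∈ K0 n) {κ : ℝ} (hκ0 : 0 < κ) (hκ : κ ≤ 1 / 2) {L : ℝ≥0} (hL : 1 + 2 * κ ≤ L) :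
    ∃ d > 0, ∀ U : Set (S n), MeasurableSet U → (∀ u ∈ U, ∀ v ∈ U, dist u v ≤ d) →
      volume (openCone (regularBoundaryOver K U)) ≤
        (L : ℝ≥0∞) ^ (2 * n + 1) * coneVolumeMeasure K U ∧
      coneVolumeMeasure K U ≤
        (L : ℝ≥0∞) ^ (2 * n + 1) * volume (openCone (regularBoundaryOver K U)) := by
  obtain ⟨r, hr, hrK⟩ := exists_closedBall_subset hK
  obtain ⟨R, hR0, hR⟩ := exists_norm_le K
  set C : ℝ := 2 + (2 * R + 3) / r with hC
  have hC0 : 0 < C := by positivity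
  set δ : ℝ := κ / C with hδ
  have hδ0 : 0 < δ := by positivity
  have hδC : δ * C = κ := div_mul_cancel₀ _ hC0.ne'
  have hδr : δ ≤ κ * r := by
    rw [hδ, div_le_iff₀ hC0, hC]
    have : κ * r * (2 + (2 * R + 3) / r) = κ * (2 * r + (2 * R + 3)) := by field_simp
    rw [this]
    nlinarith [mul_pos hκ0 hr, mul_pos hκ0 hR0]
  -- The height deviation is at most 2Rd, half from the support function and half from turning the
  -- normal; the tilt is at most d. Both are then at most δ.
  set d : ℝ := δ / (2 * R + 1) with hd
  have hd0 : 0 < d := by positivity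
  have hdδ : d * (2 * R + 1) = δ := div_mul_cancel₀ _ (by positivity)
  have hRd : 0 < R * d := by positivity
  refine ⟨d, hd0, fun U hU hUd => ?_⟩
  rcases U.eq_empty_or_nonempty with rfl | ⟨u₀, hu₀⟩
  · simp [regularBoundaryOver, openCone]
  set A := regularBoundaryOver K U with hAdef
  set s := supportFn K u₀ with hsdef
  have hu : ‖(u₀ : E n)‖ = 1 := norm_eq_of_mem_sphere u₀
  have hrs : r ≤ s := le_supportFn hr.le hrK u₀
  have hUd' : ∀ u ∈ U, ‖(u : E n) - u₀‖ ≤ d := fun u huU => by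
    rw [← dist_eq_norm]; exact hUd u huU u₀ hu₀
  have hhs : ∀ u ∈ U, |supportFn K u - s| ≤ R * d := by
    intro u huU
    have h1 := supportFn_le_add hR u u₀
    have h2 := supportFn_le_add hR u₀ u
    rw [norm_sub_rev] at h2
    have h3 : R * ‖(u : E n) - u₀‖ ≤ R * d := by gcongr; exact hUd' u huU
    rw [abs_le]
    constructor <;> linarith
  have hfr : ∀ y ∈ A, y ∈ K := fun y hy => mem_of_mem_frontier hy.1.1
  have hL1 : (1 : ℝ≥0∞) ≤ L := by
    have : (1 : ℝ) ≤ L := by linarith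
    exact_mod_cast this
  obtain ⟨hc1, hc2⟩ := volume_openCone_compare hn (A := A) (R := R) hu hr hrs hR0.le hδ0.le
    hδC.le hκ hL (measurableSet_regularBoundaryOver K hU) (fun y hy => hR y (hfr y hy))
    (by
      intro y hy
      obtain ⟨v, hvU, hv⟩ := hy.2
      have h1 := hv.supportFn_eq (hfr y hy)
      have h2 : ⟪y, (u₀ : E n)⟫ - s = (supportFn K v - s) - ⟪y, (v : E n) - u₀⟫ := by
        rw [inner_sub_right, h1]; ring
      have h3 : |⟪y, (v : E n) - u₀⟫| ≤ R * d :=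
        (abs_real_inner_le_norm _ _).trans
          (mul_le_mul (hR y (hfr y hy)) (hUd' v hvU) (norm_nonneg _) hR0.le)
      rw [h2]
      have := abs_sub (supportFn K v - s) ⟪y, (v : E n) - u₀⟫
      have := hhs v hvU
      nlinarith)
    (by
      intro y hy y' hy'
      obtain ⟨v, hvU, hv⟩ := hy.2
      obtain ⟨v', hvU', hv'⟩ := hy'.2
      refine (isOuterNormal_abs_inner_sub_le (hfr y hy) (hfr y' hy') hv hv' (hUd' v hvU)
        (hUd' v' hvU')).trans ?_
      gcongr
      nlinarith)
  have hS : (Measure.euclideanHausdorffMeasure (n - 1) : Measure (E n)) A =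
      surfaceAreaMeasure K U := (surfaceAreaMeasure_apply K hU).symm
  rw [hS] at hc1 hc2
  have hκr : R * d ≤ κ * r := by nlinarith
  obtain ⟨hm1, hm2⟩ := ofReal_mul_measure_compare (ν := surfaceAreaMeasure K) hU
    (h := fun u => supportFn K u) ((continuous_supportFn K).comp continuous_subtype_val)
    (hr.le.trans hrs) (L := L) (κ := κ) (by linarith) (fun u => (supportFn_pos hK u).le)
    (fun u huU => by
      have := (abs_le.1 (hhs u huU)).2
      nlinarith)
    (fun u huU => by
      have h1 := (abs_le.1 (hhs u huU)).1
      have h2 := le_supportFn hr.le hrK u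
      nlinarith)
  rw [← coneVolumeMeasure_apply K hU] at hm1 hm2
  constructor
  · calc _ ≤ (L : ℝ≥0∞) ^ (2 * n) * (ENNReal.ofReal (s / n) * surfaceAreaMeasure K U) := hc1
      _ ≤ (L : ℝ≥0∞) ^ (2 * n) * (L * coneVolumeMeasure K U) := by gcongr
      _ = _ := by ring
  · calc _ ≤ L * (ENNReal.ofReal (s / n) * surfaceAreaMeasure K U) := hm2
      _ ≤ L * ((L : ℝ≥0∞) ^ (2 * n) * volume (openCone A)) := by gcongr
      _ = _ := by ring

theorem volume_compare_coneVolumeMeasure_univ (hn : 1 ≤ n) {K : ConvexBody (E n)} (hK : K ∈ K0 n)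
    {κ : ℝ} (hκ0 : 0 < κ) (hκ : κ ≤ 1 / 2) {L : ℝ≥0} (hL : 1 + 2 * κ ≤ L) :
    volume (K : Set (E n)) ≤ (L : ℝ≥0∞) ^ (2 * n + 1) * coneVolumeMeasure K univ ∧
      coneVolumeMeasure K univ ≤ (L : ℝ≥0∞) ^ (2 * n + 1) * volume (K : Set (E n)) := by
  obtain ⟨d, hd, H⟩ := exists_volume_openCone_compare_coneVolumeMeasure hn hK hκ0 hκ hL
  obtain ⟨U, hUm, hUb, hUd, hU, hdisj⟩ :=
    SeparableSpace.exists_measurable_partition_diam_le (S n) hd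
  have hcone : volume (K : Set (E n)) = ∑' i, volume (openCone (regularBoundaryOver K (U i))) := by
    rw [← measure_iUnion (fun i j hij => disjoint_openCone_regularBoundaryOver hK (hdisj hij))
      (fun i => measurableSet_openCone_regularBoundaryOver hK (hUm i)), ← openCone_iUnion,
      ← volume_openCone_regularBoundary hn hK]
    congr 2
    ext x
    simp only [mem_iUnion]
    constructor
    · intro hx
      obtain ⟨u, hu, -⟩ := hx.2
      obtain ⟨i, hi⟩ := mem_iUnion.1 (hU ▸ mem_univ u)
      exact ⟨i, hx, u, hi, hu⟩
    · rintro ⟨i, hx, -⟩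
      exact hx
  have hmass : coneVolumeMeasure K univ = ∑' i, coneVolumeMeasure K (U i) := by
    rw [← hU, measure_iUnion hdisj hUm]
  rw [hcone, hmass, ← ENNReal.tsum_mul_left, ← ENNReal.tsum_mul_left]
  have hpiece := fun i => H (U i) (hUm i) fun u hu v hv =>
    (Metric.dist_le_diam_of_mem (hUb i) hu hv).trans (hUd i)
  exact ⟨ENNReal.tsum_le_tsum fun i => (hpiece i).1, ENNReal.tsum_le_tsum fun i => (hpiece i).2⟩

/-- The cone-volume formula `|K| = (1/n) ∫ h_K dS(K, ·)`. -/
theorem coneVolumeMeasure_univ (hn : 1 ≤ n) {K : ConvexBody (E n)} (hK : K ∈ K0 n) :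
    coneVolumeMeasure K univ = volume (K : Set (E n)) := by
  set L : ℕ → ℝ≥0 := fun k => 1 + 1 / ((k : ℝ≥0) + 1) with hLdef
  have hlim : ∀ c : ℝ≥0∞, Filter.Tendsto (fun k => (L k : ℝ≥0∞) ^ (2 * n + 1) * c)
      Filter.atTop (𝓝 c) := by
    intro c
    have h1 : Filter.Tendsto L Filter.atTop (𝓝 1) := by
      have := (tendsto_one_div_add_atTop_nhds_zero_nat (𝕜 := ℝ≥0)).const_add (1 : ℝ≥0)
      simpa [hLdef] using this
    have h2 : Filter.Tendsto (fun k => ((L k ^ (2 * n + 1) : ℝ≥0) : ℝ≥0∞)) Filter.atTop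
        (𝓝 ((1 : ℝ≥0) : ℝ≥0∞)) := by
      rw [ENNReal.tendsto_coe]
      simpa using h1.pow (2 * n + 1)
    have h3 := ENNReal.Tendsto.mul_const (b := c) h2 (Or.inl (by simp))
    simpa using h3
  -- This κ makes 1 + 2κ equal to `L k`, and k = 0 gives the largest allowed value 1/2.
  have hk : ∀ k : ℕ, _ := fun k =>
    volume_compare_coneVolumeMeasure_univ hn hK (κ := 1 / (2 * ((k : ℝ) + 1))) (L := L k)
      (by positivity) (by
        rw [div_le_div_iff₀ (by positivity) (by positivity)]
        have : (0 : ℝ) ≤ k := k.cast_nonneg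
        linarith)
      (by rw [hLdef]; push_cast; apply le_of_eq; field_simp)
  exact le_antisymm (ge_of_tendsto' (hlim _) fun k => (hk k).2)
    (ge_of_tendsto' (hlim _) fun k => (hk k).1)

/-! ### Power means and the normalized functional -/

/-- Monotonicity in the exponent of the power means of a function, for nonzero exponents of
arbitrary sign. -/
theorem lintegral_rpow_rpow_inv_mono {α : Type*} [MeasurableSpace α] {μ : Measure α}
    [IsProbabilityMeasure μ] {F : α → ℝ≥0∞} (hF : Measurable F) (hF0 : ∀ x, F x ≠ 0)
    (hFt : ∀ x, F x ≠ ∞) {p q : ℝ} (hp : p ≠ 0) (hq : q ≠ 0) (hqp : q < p) :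
    (∫⁻ x, F x ^ q ∂μ) ^ q⁻¹ ≤ (∫⁻ x, F x ^ p ∂μ) ^ p⁻¹ := by
  have pos : ∀ (G : α → ℝ≥0∞), Measurable G → ∀ a b : ℝ, 0 < a → a ≤ b →
      (∫⁻ x, G x ^ a ∂μ) ^ a⁻¹ ≤ (∫⁻ x, G x ^ b ∂μ) ^ b⁻¹ := by
    intro G hG a b ha hab
    have := eLpNorm'_le_eLpNorm'_of_exponent_le ha hab μ hG.aestronglyMeasurable
    simpa [eLpNorm', one_div] using this
  rcases lt_or_gt_of_ne hq with hq0 | hq0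
  · rcases lt_or_gt_of_ne hp with hp0 | hp0
    -- Two negative exponents reduce to two positive ones for 1/F.
    · have := pos (fun x => (F x)⁻¹) hF.inv (-p) (-q) (by linarith) (by linarith)
      simp only [ENNReal.inv_rpow, ENNReal.rpow_neg, inv_inv, inv_neg] at this
      exact ENNReal.inv_le_inv.1 this
    · have hpq : 0 < p - q := by linarith
      have hconj : Real.HolderConjugate ((p - q) / -q) ((p - q) / p) := by
        refine Real.holderConjugate_iff.2 ⟨?_, ?_⟩
        · rw [lt_div_iff₀ (by linarith)]; linarith
        · rw [inv_div, inv_div]; field_simp; ring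
      set s : ℝ := p * -q / (p - q) with hs
      -- For q < 0 < p, Hölder is applied to 1 = F^s F^(-s), with `s` chosen so that the two
      -- integrands become F^p and F^q. Raising to the power 1/s then gives the exponents 1/p and
      -- -1/q.
      have hH := ENNReal.lintegral_mul_le_Lp_mul_Lq μ hconj
        (f := fun x => F x ^ s) (g := fun x => F x ^ (-s))
        (hF.pow_const _).aemeasurable (hF.pow_const _).aemeasurable
      have h1 : ∀ x, ((fun x => F x ^ s) * fun x => F x ^ (-s)) x = 1 := fun x => by
        rw [Pi.mul_apply, ← ENNReal.rpow_add _ _ (hF0 x) (hFt x), add_neg_cancel,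
          ENNReal.rpow_zero]
      have e1 : s * ((p - q) / -q) = p := by rw [hs]; field_simp
      have e2 : -s * ((p - q) / p) = q := by rw [hs]; field_simp
      simp only [h1, ← ENNReal.rpow_mul, e1, e2, lintegral_const, measure_univ, mul_one] at hH
      have he : 0 ≤ (p - q) / (p * -q) := by
        have : 0 < p * -q := mul_pos hp0 (by linarith)
        positivity
      have h2 := ENNReal.rpow_le_rpow hH he
      rw [ENNReal.one_rpow, ENNReal.mul_rpow_of_nonneg _ _ he, ← ENNReal.rpow_mul,
        ← ENNReal.rpow_mul] at h2
      have e3 : 1 / ((p - q) / -q) * ((p - q) / (p * -q)) = p⁻¹ := by field_simp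
      have e4 : 1 / ((p - q) / p) * ((p - q) / (p * -q)) = -q⁻¹ := by field_simp
      rw [e3, e4, ENNReal.rpow_neg] at h2
      rw [← div_eq_mul_inv] at h2
      have := ENNReal.mul_le_of_le_div h2
      rwa [one_mul] at this
  · exact pos F hF q p hq0 hqp.le

theorem volume_convexBody_ne_top (K : ConvexBody (E n)) : volume (K : Set (E n)) ≠ ∞ :=
  K.isCompact.measure_lt_top.ne

theorem volume_convexBody_ne_zero {K : ConvexBody (E n)} (hK : K ∈ K0 n) :
    volume (K : Set (E n)) ≠ 0 :=
  (Measure.measure_pos_of_mem_nhds volume (mem_nhds_zero hK)).ne'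

theorem volume_polarBody_ne_top {Q : ConvexBody (E n)} (hQ : Q ∈ K0 n) :
    volume (polarBody Q) ≠ ∞ := by
  obtain ⟨r, hr, h⟩ := exists_closedBall_subset hQ
  have hsub : polarBody Q ⊆ Metric.closedBall 0 r⁻¹ := by
    intro y hy
    rw [mem_closedBall_zero_iff]
    rcases eq_or_ne y 0 with rfl | hy0
    · simp [hr.le]
    have hn : 0 < ‖y‖ := norm_pos_iff.2 hy0
    have h1 : (r / ‖y‖) • y ∈ Q := by
      apply h
      rw [mem_closedBall_zero_iff, norm_smul, Real.norm_of_nonneg (by positivity),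
        div_mul_cancel₀ _ hn.ne']
    have h2 := hy _ h1
    rw [inner_smul_left, real_inner_self_eq_norm_sq] at h2
    simp only [conj_trivial] at h2
    have h3 : r / ‖y‖ * ‖y‖ ^ 2 = r * ‖y‖ := by field_simp
    rw [h3] at h2
    rwa [← one_div, le_div_iff₀ hr, mul_comm]
  exact ((measure_mono hsub).trans_lt measure_closedBall_lt_top).ne

theorem volume_polarBody_ne_zero (Q : ConvexBody (E n)) : volume (polarBody Q) ≠ 0 := by
  obtain ⟨R, hR, h⟩ := exists_norm_le Q
  have hsub : Metric.ball (0 : E n) R⁻¹ ⊆ polarBody Q := by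
    intro y hy x hx
    rw [mem_ball_zero_iff] at hy
    calc ⟪x, y⟫ ≤ ‖x‖ * ‖y‖ := real_inner_le_norm _ _
      _ ≤ R * R⁻¹ := mul_le_mul (h x hx) hy.le (norm_nonneg _) hR.le
      _ = 1 := mul_inv_cancel₀ hR.ne'
  exact ((Metric.measure_ball_pos volume 0 (by positivity)).trans_le (measure_mono hsub)).ne'

/-- The cone-volume measure normalized to total mass one. -/
def coneProbabilityMeasure (K : ConvexBody (E n)) : Measure (S n) :=
  (volume (K : Set (E n)))⁻¹ • coneVolumeMeasure K

theorem isProbabilityMeasure_coneProbabilityMeasure (hn : 1 ≤ n) {K : ConvexBody (E n)}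
    (hK : K ∈ K0 n) : IsProbabilityMeasure (coneProbabilityMeasure K) := by
  refine ⟨?_⟩
  rw [coneProbabilityMeasure, Measure.smul_apply, coneVolumeMeasure_univ hn hK, smul_eq_mul,
    ENNReal.inv_mul_cancel (volume_convexBody_ne_zero hK) (volume_convexBody_ne_top K)]

/-- The ratio `h_Q / h_K` of support functions. -/
def supportRatio (K Q : ConvexBody (E n)) (u : S n) : ℝ≥0∞ :=
  ENNReal.ofReal (supportFn Q u / supportFn K u)

theorem continuous_supportRatio {K : ConvexBody (E n)} (hK : K ∈ K0 n) (Q : ConvexBody (E n)) :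
    Continuous (supportRatio K Q) := by
  refine ENNReal.continuous_ofReal.comp (Continuous.div ?_ ?_ fun u => (supportFn_pos hK u).ne')
  · exact (continuous_supportFn Q).comp continuous_subtype_val
  · exact (continuous_supportFn K).comp continuous_subtype_val

theorem supportRatio_ne_zero {K Q : ConvexBody (E n)} (hK : K ∈ K0 n) (hQ : Q ∈ K0 n) (u : S n) :
    supportRatio K Q u ≠ 0 :=
  (ENNReal.ofReal_pos.2 (div_pos (supportFn_pos hQ u) (supportFn_pos hK u))).ne'

theorem supportRatio_self {K : ConvexBody (E n)} (hK : K ∈ K0 n) (u : S n) :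
    supportRatio K K u = 1 := by
  rw [supportRatio, div_self (supportFn_pos hK u).ne', ENNReal.ofReal_one]

/-- Pointwise h_Q^p h_K^(1-p) = h_K (h_Q/h_K)^p, so the weight is absorbed into the cone-volume
measure. -/
theorem mixedVolume_eq {K Q : ConvexBody (E n)} (hK : K ∈ K0 n) (hQ : Q ∈ K0 n) (p : ℝ) :
    mixedVolume p K Q =
      volume (K : Set (E n)) * ∫⁻ u, supportRatio K Q u ^ p ∂(coneProbabilityMeasure K) := by
  have hcK : Continuous fun u : S n => supportFn K u :=
    (continuous_supportFn K).comp continuous_subtype_val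
  have hcQ : Continuous fun u : S n => supportFn Q u :=
    (continuous_supportFn Q).comp continuous_subtype_val
  rw [coneProbabilityMeasure, coneVolumeMeasure, lintegral_smul_measure, lintegral_smul_measure,
    smul_eq_mul, smul_eq_mul, ← mul_assoc, ENNReal.mul_inv_cancel (volume_convexBody_ne_zero hK)
      (volume_convexBody_ne_top K), one_mul, mixedVolume, pSurfaceAreaMeasure]
  congr 1
  rw [lintegral_withDensity_eq_lintegral_mul _ (hcK.measurable.pow_const _).ennreal_ofReal
      (hcQ.measurable.pow_const _).ennreal_ofReal,
    lintegral_withDensity_eq_lintegral_mul _ hcK.measurable.ennreal_ofReal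
      ((continuous_supportRatio hK Q).measurable.pow_const p)]
  refine lintegral_congr fun u => ?_
  have hk := supportFn_pos hK u
  have hq := supportFn_pos hQ u
  simp only [Pi.mul_apply, supportRatio]
  rw [ENNReal.ofReal_rpow_of_pos (div_pos hq hk), ← ENNReal.ofReal_mul (by positivity),
    ← ENNReal.ofReal_mul hk.le]
  congr 1
  rw [Real.div_rpow hq.le hk.le, Real.rpow_sub hk, Real.rpow_one]
  ring

/-- The ratio is continuous and positive on a compact sphere. Excluding 0 and ∞ is needed for the
power laws in [0, ∞] with exponents of either sign. -/
theorem lintegral_supportRatio_rpow_ne (hn : 1 ≤ n) {K Q : ConvexBody (E n)} (hK : K ∈ K0 n)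
    (hQ : Q ∈ K0 n) (p : ℝ) :
    ∫⁻ u, supportRatio K Q u ^ p ∂(coneProbabilityMeasure K) ≠ 0 ∧
      ∫⁻ u, supportRatio K Q u ^ p ∂(coneProbabilityMeasure K) ≠ ∞ := by
  have := isProbabilityMeasure_coneProbabilityMeasure hn hK
  have hpos : ∀ u : S n, supportRatio K Q u ^ p ≠ 0 := fun u =>
    (ENNReal.rpow_pos (supportRatio_ne_zero hK hQ u).bot_lt ENNReal.ofReal_ne_top).ne'
  constructor
  · intro h
    rw [lintegral_eq_zero_iff ((continuous_supportRatio hK Q).measurable.pow_const p)] at h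
    obtain ⟨u, hu⟩ := h.exists
    exact hpos u hu
  · have hc : Continuous fun u : S n => (supportRatio K Q u ^ p) :=
      (ENNReal.continuous_rpow_const (y := p)).comp (continuous_supportRatio hK Q)
    have hcpt := isCompact_univ (X := S n)
    obtain ⟨u₀⟩ : Nonempty (S n) := by
      by_contra hne
      rw [not_nonempty_iff] at hne
      have h1 := measure_univ (μ := coneProbabilityMeasure K)
      rw [univ_eq_empty_iff.2 hne, measure_empty] at h1
      exact zero_ne_one h1
    obtain ⟨u, -, hu⟩ := hcpt.exists_isMaxOn ⟨u₀, mem_univ _⟩ hc.continuousOn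
    have hle : ∫⁻ u, supportRatio K Q u ^ p ∂(coneProbabilityMeasure K) ≤
        supportRatio K Q u ^ p := by
      calc _ ≤ ∫⁻ _, supportRatio K Q u ^ p ∂(coneProbabilityMeasure K) :=
            lintegral_mono fun v => hu (mem_univ v)
        _ = _ := by simp
    refine ne_top_of_le_ne_top ?_ hle
    exact ENNReal.rpow_ne_top_of_ne_zero (supportRatio_ne_zero hK hQ u) ENNReal.ofReal_ne_top

/-- The quantity `‖h_Q / h_K‖_p ^ n |Q°| / |K|`, where the norm refers to the normalized
cone-volume measure. -/
def normalizedFunctional (p : ℝ) (K Q : ConvexBody (E n)) : ℝ≥0∞ :=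
  ((∫⁻ u, supportRatio K Q u ^ p ∂(coneProbabilityMeasure K)) ^ p⁻¹) ^ (n : ℝ) *
    (volume (polarBody Q) / volume (K : Set (E n)))

theorem normalizedFunctional_mono (hn : 1 ≤ n) {K Q : ConvexBody (E n)} (hK : K ∈ K0 n)
    (hQ : Q ∈ K0 n) {p q : ℝ} (hp : p ≠ 0) (hq : q ≠ 0) (hqp : q < p) :
    normalizedFunctional q K Q ≤ normalizedFunctional p K Q := by
  have := isProbabilityMeasure_coneProbabilityMeasure hn hK
  unfold normalizedFunctional
  gcongr
  exact lintegral_rpow_rpow_inv_mono (continuous_supportRatio hK Q).measurable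
    (supportRatio_ne_zero hK hQ) (fun _ => ENNReal.ofReal_ne_top) hp hq hqp

theorem normalizedFunctional_self (hn : 1 ≤ n) {K : ConvexBody (E n)} (hK : K ∈ K0 n) (p : ℝ) :
    normalizedFunctional p K K = volume (polarBody K) / volume (K : Set (E n)) := by
  have := isProbabilityMeasure_coneProbabilityMeasure hn hK
  simp [normalizedFunctional, supportRatio_self hK]

theorem geominimalFunctional_div_rpow (hn : 1 ≤ n) {K Q : ConvexBody (E n)} (hK : K ∈ K0 n)
    (hQ : Q ∈ K0 n) {p : ℝ} (hp : p ≠ 0) (hnp : (n : ℝ) + p ≠ 0) :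
    (geominimalFunctional p K Q / ((n : ℝ≥0∞) * volume (K : Set (E n)))) ^ (((n : ℝ) + p) / p) =
      normalizedFunctional p K Q := by
  obtain ⟨hI0, hIt⟩ := lintegral_supportRatio_rpow_ne hn hK hQ p
  have hV0 := volume_convexBody_ne_zero hK
  have hVt := volume_convexBody_ne_top K
  have hP0 := volume_polarBody_ne_zero Q
  have hPt := volume_polarBody_ne_top hQ
  have hn0 : (n : ℝ≥0∞) ≠ 0 := by exact_mod_cast (by omega : n ≠ 0)
  have hnt : (n : ℝ≥0∞) ≠ ∞ := ENNReal.natCast_ne_top n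
  unfold geominimalFunctional normalizedFunctional
  rw [mixedVolume_eq hK hQ]
  set I := ∫⁻ u, supportRatio K Q u ^ p ∂(coneProbabilityMeasure K)
  set V := volume (K : Set (E n))
  set P := volume (polarBody Q)
  have hPV0 : P / V ≠ 0 := ENNReal.div_ne_zero.2 ⟨hP0, hVt⟩
  have hPVt : P / V ≠ ∞ := ENNReal.div_ne_top hPt hV0
  have hP : P = V * (P / V) := (ENNReal.mul_div_cancel hV0 hVt).symm
  have hsplit : (n : ℝ≥0∞) * (V * I) ^ ((n : ℝ) / (n + p)) * P ^ (p / ((n : ℝ) + p)) =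
      ((n : ℝ≥0∞) * V) * (I ^ ((n : ℝ) / (n + p)) * (P / V) ^ (p / ((n : ℝ) + p))) := by
    -- The two exponents sum to one, so exactly one factor |K| comes out.
    have hVV : V ^ ((n : ℝ) / (n + p)) * V ^ (p / ((n : ℝ) + p)) = V := by
      rw [← ENNReal.rpow_add _ _ hV0 hVt, ← add_div, div_self hnp, ENNReal.rpow_one]
    conv_lhs => rw [hP]
    rw [ENNReal.mul_rpow_of_ne_top hVt hIt, ENNReal.mul_rpow_of_ne_top hVt hPVt]
    calc _ = (n : ℝ≥0∞) * (V ^ ((n : ℝ) / (n + p)) * V ^ (p / ((n : ℝ) + p))) *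
          (I ^ ((n : ℝ) / (n + p)) * (P / V) ^ (p / ((n : ℝ) + p))) := by ring
      _ = _ := by rw [hVV]
  rw [hsplit, mul_comm ((n : ℝ≥0∞) * V), ENNReal.mul_div_cancel_right (mul_ne_zero hn0 hV0)
    (ENNReal.mul_ne_top hnt hVt), ENNReal.mul_rpow_of_ne_top
      (ENNReal.rpow_ne_top_of_ne_zero hI0 hIt) (ENNReal.rpow_ne_top_of_ne_zero hPV0 hPVt),
    ← ENNReal.rpow_mul, ← ENNReal.rpow_mul, ← ENNReal.rpow_mul]
  have e1 : (n : ℝ) / (n + p) * ((n + p) / p) = p⁻¹ * n := by field_simp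
  have e2 : p / ((n : ℝ) + p) * ((n + p) / p) = 1 := by field_simp
  rw [e1, e2, ENNReal.rpow_one]

/-! ### Extrema under powers and the two ranges of the exponent -/

theorem iInf_rpow {ι : Sort*} (f : ι → ℝ≥0∞) {e : ℝ} (he : 0 < e) :
    (⨅ i, f i) ^ e = ⨅ i, f i ^ e :=
  (ENNReal.orderIsoRpow e he).map_iInf f

theorem iSup_rpow {ι : Sort*} (f : ι → ℝ≥0∞) {e : ℝ} (he : 0 < e) :
    (⨆ i, f i) ^ e = ⨆ i, f i ^ e :=
  (ENNReal.orderIsoRpow e he).map_iSup f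

theorem iSup_rpow_of_neg {ι : Sort*} (f : ι → ℝ≥0∞) {e : ℝ} (he : e < 0) :
    (⨆ i, f i) ^ e = ⨅ i, f i ^ e := by
  have h : ∀ x : ℝ≥0∞, x ^ e = (x ^ (-e))⁻¹ := fun x => by rw [ENNReal.rpow_neg, inv_inv]
  simp_rw [h]
  rw [iSup_rpow _ (neg_pos.2 he), ENNReal.inv_iSup]

theorem natCast_mul_volume_ne (hn : 1 ≤ n) {K : ConvexBody (E n)} (hK : K ∈ K0 n) :
    (n : ℝ≥0∞) * volume (K : Set (E n)) ≠ 0 ∧ (n : ℝ≥0∞) * volume (K : Set (E n)) ≠ ∞ :=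
  ⟨mul_ne_zero (by exact_mod_cast (by omega : n ≠ 0)) (volume_convexBody_ne_zero hK),
    ENNReal.mul_ne_top (ENNReal.natCast_ne_top n) (volume_convexBody_ne_top K)⟩

theorem geominimal_div_rpow_eq_iInf (hn : 1 ≤ n) {K : ConvexBody (E n)} (hK : K ∈ K0 n)
    {p : ℝ} (hp : p ≠ 0) (hnp : -(n : ℝ) < p) :
    (geominimal p K / ((n : ℝ≥0∞) * volume (K : Set (E n)))) ^ (((n : ℝ) + p) / p) =
      ⨅ Q : K0 n, normalizedFunctional p K Q := by
  obtain ⟨hc0, hct⟩ := natCast_mul_volume_ne hn hK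
  have hnp' : 0 < (n : ℝ) + p := by linarith
  unfold geominimal
  split_ifs with h0
  · have hp0 : 0 < p := lt_of_le_of_ne h0 hp.symm
    rw [iInf_subtype', ENNReal.iInf_div_of_ne hc0 hct, iInf_rpow _ (div_pos hnp' hp0)]
    exact iInf_congr fun Q => geominimalFunctional_div_rpow hn hK Q.2 hp hnp'.ne'
  · rw [iSup_subtype', ENNReal.iSup_div,
      iSup_rpow_of_neg _ (div_neg_of_pos_of_neg hnp' (by linarith))]
    exact iInf_congr fun Q => geominimalFunctional_div_rpow hn hK Q.2 hp hnp'.ne'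

theorem geominimal_div_rpow_eq_iSup (hn : 1 ≤ n) {K : ConvexBody (E n)} (hK : K ∈ K0 n)
    {p : ℝ} (hp : p ≠ 0) (hnp : p < -(n : ℝ)) :
    (geominimal p K / ((n : ℝ≥0∞) * volume (K : Set (E n)))) ^ (((n : ℝ) + p) / p) =
      ⨆ Q : K0 n, normalizedFunctional p K Q := by
  have hnp' : (n : ℝ) + p < 0 := by linarith
  have hp0 : p < 0 := by linarith [(n.cast_nonneg : (0 : ℝ) ≤ n)]
  rw [geominimal, if_neg (by linarith), iSup_subtype', ENNReal.iSup_div,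
    iSup_rpow _ (div_pos_of_neg_of_neg hnp' hp0)]
  exact iSup_congr fun Q => geominimalFunctional_div_rpow hn hK Q.2 hp hnp'.ne

end Geominimal

end

theorem theorem5p2 (n : ℕ) (hn : 1 ≤ n) (K : ConvexBody (EuclideanSpace ℝ (Fin n)))
    (hK : K ∈ Geominimal.K0 n) (p q : ℝ) (hp : p ≠ 0) (hq : q ≠ 0) :
    (((-(n : ℝ) < q ∧ q < p) ∨ (q < p ∧ p < -(n : ℝ))) →
      (Geominimal.geominimal q K / ((n : ENNReal) *
            MeasureTheory.volume (K : Set (EuclideanSpace ℝ (Fin n))))) ^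
          (((n : ℝ) + q) / q) ≤
        (Geominimal.geominimal p K / ((n : ENNReal) *
            MeasureTheory.volume (K : Set (EuclideanSpace ℝ (Fin n))))) ^
          (((n : ℝ) + p) / p)) ∧
    ((q < -(n : ℝ) ∧ -(n : ℝ) < p) →
      (Geominimal.geominimal q K / ((n : ENNReal) *
            MeasureTheory.volume (K : Set (EuclideanSpace ℝ (Fin n))))) ^
          (((n : ℝ) + q) / q) ≥
        (Geominimal.geominimal p K / ((n : ENNReal) *
            MeasureTheory.volume (K : Set (EuclideanSpace ℝ (Fin n))))) ^
          (((n : ℝ) + p) / p)) := by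
  refine ⟨?_, ?_⟩
  · rintro (⟨hnq, hqp⟩ | ⟨hqp, hpn⟩)
    · rw [Geominimal.geominimal_div_rpow_eq_iInf hn hK hq hnq,
        Geominimal.geominimal_div_rpow_eq_iInf hn hK hp (hnq.trans hqp)]
      exact iInf_mono fun Q => Geominimal.normalizedFunctional_mono hn hK Q.2 hp hq hqp
    · rw [Geominimal.geominimal_div_rpow_eq_iSup hn hK hq (hqp.trans hpn),
        Geominimal.geominimal_div_rpow_eq_iSup hn hK hp hpn]
      exact iSup_mono fun Q => Geominimal.normalizedFunctional_mono hn hK Q.2 hp hq hqp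
  · rintro ⟨hqn, hnp⟩
    rw [Geominimal.geominimal_div_rpow_eq_iSup hn hK hq hqn,
      Geominimal.geominimal_div_rpow_eq_iInf hn hK hp hnp]
    -- The test body Q = K has ratio identically one, so its value is the same for both exponents.
    calc _ ≤ Geominimal.normalizedFunctional p K K := iInf_le _ (⟨K, hK⟩ : Geominimal.K0 n)
      _ = Geominimal.normalizedFunctional q K K := by
        rw [Geominimal.normalizedFunctional_self hn hK, Geominimal.normalizedFunctional_self hn hK]
      _ ≤ _ := le_iSup (fun Q : Geominimal.K0 n => Geominimal.normalizedFunctional q K Q) ⟨K, hK⟩
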